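/- Let $d\ge 1$ and let $\mathbb{S}^{d-1}=\{x\in\mathbb{R}^d:\|x\|_2=1\}$. Let $\mathcal D$ be a probability distribution on $\mathbb{S}^{d-1}$ and let $f:\mathbb{S}^{d-1}\times\mathbb{S}^{d-1}\to\mathbb{R}^d$ be a (measurable) function with $x+f(x,\xi)\neq 0$ for all $x,\xi\in\mathbb{S}^{d-1}$. Consider the time-homogeneous Markov chain on $\mathbb{S}^{d-1}$ (the geometric opinion dynamics of a single agent) $$X_{t+1}=F(X_t,\xi_t),\qquad F(x,\xi)=\frac{x+f(x,\xi)}{\|x+f(x,\xi)\|_2},$$ where $\xi_0,\xi_1,\dots$ are drawn i.i.d. from $\mathcal D$, independently of $X_0$; write $\Pr_x$ for its law when $X_0=x$. Suppose that the dynamics are continuous in the current state, i.e. $x\mapsto F(x,\xi)$ is continuous on $\mathbb{S}^{d-1}$ for every fixed $\xi$. Then there exists an invariant distribution, i.e. a probability measure $\mu$ on $\mathbb{S}^{d-1}$ such that $X_0\sim\mu$ implies $X_1\sim\mu$. Assume moreover that 1. there is a point $y\in\mathbb{S}^{d-1}$ such that for every open neighborhood $U$ of $y$ and every $x\in\mathbb{S}^{d-1}$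 there is a time $t=t(x,U)\ge 0$ with $\Pr_x(X_t\in U)>0$; and 2. the dynamics admit a continuous density with respect to the standard Haar (normalized rotation-invariant) measure $\sigma$ on $\mathbb{S}^{d-1}$: for every $x$ the distribution of $X_1$ given $X_0=x$ has a density $p(x,\cdot)$ with respect to $\sigma$, where $p:\mathbb{S}^{d-1}\times\mathbb{S}^{d-1}\to[0,\infty)$ is continuous in at least one of its arguments (that is, either $z\mapsto p(x,z)$ is continuous for every $x$, or $x\mapsto p(x,z)$ is continuous for every $z$; in particular, this holds if $p$ is jointly continuous). Then the invariant distribution is unique. -/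

import Mathlib

open MeasureTheory ProbabilityTheory
open scoped NNReal ENNReal

/-- The unit sphere `𝕊^{d-1}` of `ℝ^d` with the Euclidean norm. -/
abbrev OpinionSphere (d : ℕ) : Type := Metric.sphere (0 : EuclideanSpace ℝ (Fin d)) 1

/-- The projection `P(v) = v / ‖v‖` of a nonzero vector onto the unit sphere. -/
noncomputable def sphereProj {d : ℕ} (v : EuclideanSpace ℝ (Fin d)) (hv : v ≠ 0) :
    OpinionSphere d :=
  ⟨‖v‖⁻¹ • v, by
    rw [mem_sphere_zero_iff_norm, norm_smul, norm_inv, norm_norm,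
      inv_mul_cancel₀ (norm_ne_zero_iff.mpr hv)]⟩

/-- The standard Haar measure on `𝕊^{d-1}`: the surface measure induced by Lebesgue measure,
normalized to total mass one. -/
noncomputable def sphereHaar (d : ℕ) : Measure (OpinionSphere d) :=
  ((volume : Measure (EuclideanSpace ℝ (Fin d))).toSphere Set.univ)⁻¹ •
    (volume : Measure (EuclideanSpace ℝ (Fin d))).toSphere

/-- Geometric opinion dynamics of one agent, `X_{t+1} ∝ X_t + f(X_t, ξ_t)` with `ξ_t ∈ 𝕊^{d-1}`
drawn i.i.d. from the distribution `D`; the unnormalized vector is never zero. -/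
structure SingleAgentDynamics (d : ℕ) where
  /-- the updating function -/
  f : OpinionSphere d → OpinionSphere d → EuclideanSpace ℝ (Fin d)
  /-- the distribution of the random stimulus -/
  D : Measure (OpinionSphere d)
  measurable_f : Measurable (Function.uncurry f)
  isProbabilityMeasure_D : IsProbabilityMeasure D
  add_f_ne_zero : ∀ x ξ : OpinionSphere d, (x : EuclideanSpace ℝ (Fin d)) + f x ξ ≠ 0

namespace SingleAgentDynamics

variable {d : ℕ} (M : SingleAgentDynamics d)

/-- The new opinion `P(x + f(x, ξ))` of an agent with opinion `x` under the stimulus `ξ`. -/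
noncomputable def step (x ξ : OpinionSphere d) : OpinionSphere d :=
  sphereProj ((x : EuclideanSpace ℝ (Fin d)) + M.f x ξ) (M.add_f_ne_zero x ξ)

theorem measurable_step : Measurable (Function.uncurry M.step) := by
  have h : Measurable fun q : OpinionSphere d × OpinionSphere d =>
      (q.1 : EuclideanSpace ℝ (Fin d)) + M.f q.1 q.2 :=
    (measurable_subtype_coe.comp measurable_fst).add M.measurable_f
  exact (h.norm.inv.smul h).subtype_mk

/-- The transition kernel of the Markov chain: from `x`, the law of `P(x + f(x, ξ))`, `ξ ∼ D`. -/
noncomputable def transition : Kernel (OpinionSphere d) (OpinionSphere d) where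
  toFun x := M.D.map (M.step x)
  measurable' := by
    have := M.isProbabilityMeasure_D
    refine Measure.measurable_of_measurable_coe _ fun s hs => ?_
    have h : ∀ x, M.D.map (M.step x) s =
        M.D (Prod.mk x ⁻¹' (Function.uncurry M.step ⁻¹' s)) := fun x =>
      Measure.map_apply (M.measurable_step.comp measurable_prodMk_left) hs
    simp_rw [h]
    exact measurable_measure_prodMk_left (M.measurable_step hs)

/-- The dynamics are continuous in the current state, for every realization of the stimulus. -/
def IsContinuous : Prop :=
  ∀ ξ, Continuous fun x => M.step x ξ

/-- `μ` is an invariant distribution: a probability measure such that `X_0 ∼ μ` implies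
`X_1 ∼ μ`. -/
def IsInvariantDistribution (μ : Measure (OpinionSphere d)) : Prop :=
  IsProbabilityMeasure μ ∧ M.transition.Invariant μ

/-- Every neighbourhood of `y` is reached with positive probability from every starting point;
`(M.transition ^ t) x` is the law of `X_t` for the chain with `X_0 = x`. -/
def IsAccessible (y : OpinionSphere d) : Prop :=
  ∀ U : Set (OpinionSphere d), IsOpen U → y ∈ U →
    ∀ x, ∃ t : ℕ, 0 < (M.transition ^ t) x U

/-- For every `x` the law of `X_1` given `X_0 = x` has a density `p x` with respect to Haar
measure, where `p` is continuous. It is only required that `p` be continuous in one of its two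
arguments (in the new state, or in the current state); in particular a jointly continuous density
qualifies. -/
def HasContinuousDensity : Prop :=
  ∃ p : OpinionSphere d → OpinionSphere d → ℝ≥0,
    (∀ x, Measurable (p x)) ∧
    (∀ x, M.transition x = (sphereHaar d).withDensity fun y => (p x y : ℝ≥0∞)) ∧
    ((∀ x, Continuous fun y => p x y) ∨ (∀ y, Continuous fun x => p x y))

end SingleAgentDynamics

open Filter Topology BoundedContinuousFunction

/-! Existence is Krylov–Bogolyubov: the kernel is Feller on a compact space. For uniqueness, two
distinct invariant laws `μ`, `ν` give nonzero, mutually singular measures `μ - ν` and `ν - μ`, again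
invariant (`Invariant.sub`) and carried by `sᶜ` and `s`. Almost every state of each avoids the
other's carrier in one step, and accessibility makes `y` adherent to every set of full measure
(`Invariant.mem_closure_of_ae_mem`). So `y` is a limit both of states avoiding `s` and of states
avoiding `sᶜ`, which either form of continuity of the density forbids. -/

theorem MeasureTheory.Measure.add_sub_comm_of_isFiniteMeasure {α : Type*} {mα : MeasurableSpace α}
    (μ ν : Measure α) [IsFiniteMeasure μ] [IsFiniteMeasure ν] :
    μ + (ν - μ) = ν + (μ - ν) := by
  have h := sub_toSignedMeasure_eq_toSignedMeasure_sub (μ := μ) (ν := ν)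
  rw [sub_eq_sub_iff_add_eq_add, ← toSignedMeasure_add, ← toSignedMeasure_add] at h
  rw [toSignedMeasure_eq_toSignedMeasure_iff.1 h, add_comm]

namespace ProbabilityTheory.Kernel

/-! ### Jordan parts of invariant measures -/

section Invariance

variable {α : Type*} {mα : MeasurableSpace α} {κ : Kernel α α} {μ ν : Measure α}

theorem Invariant.pow (hμ : κ.Invariant μ) (n : ℕ) : (κ ^ n).Invariant μ := by
  induction n with
  | zero => exact Measure.bind_dirac
  | succ n ih =>
    rw [_root_.pow_succ']
    exact hμ.comp ih

/-- The positive part of the difference of two finite invariant measures is invariant. -/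
theorem Invariant.sub [IsMarkovKernel κ] [IsFiniteMeasure μ] [IsFiniteMeasure ν]
    (hμ : κ.Invariant μ) (hν : κ.Invariant ν) : κ.Invariant (μ - ν) := by
  have hadd := μ.add_sub_comm_of_isFiniteMeasure ν
  have hbind : μ + (ν - μ).bind κ = ν + (μ - ν).bind κ := by
    have h := congrArg (fun ρ : Measure α => ρ.bind κ) hadd
    simp only [Measure.comp_add] at h
    rwa [hμ.def, hν.def] at h
  -- Invariance of the signed difference, written additively because subtraction of measures is
  -- truncated.
  have hbalance (s : Set α) : (ν - μ) s + (μ - ν).bind κ s = (μ - ν) s + (ν - μ).bind κ s := by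
    have h₁ := congrArg (fun ρ : Measure α => ρ s) hadd
    have h₂ := congrArg (fun ρ : Measure α => ρ s) hbind
    simp only [Measure.add_apply] at h₁ h₂
    have hfin : μ s + ν s ≠ ∞ := ENNReal.add_ne_top.2 ⟨measure_ne_top _ _, measure_ne_top _ _⟩
    rw [← ENNReal.add_right_inj hfin]
    calc μ s + ν s + ((ν - μ) s + (μ - ν).bind κ s)
        = (μ s + (ν - μ) s) + (ν s + (μ - ν).bind κ s) := by ring
      _ = (ν s + (μ - ν) s) + (μ s + (ν - μ).bind κ s) := by rw [h₁, h₂]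
      _ = μ s + ν s + ((μ - ν) s + (ν - μ).bind κ s) := by ring
  obtain ⟨s, hs, hs₁, hs₂⟩ := Measure.mutually_singular_measure_sub (μ := μ) (ν := ν)
  -- Off `s` the measure `ν - μ` vanishes, so the balance gives domination there; `s` itself is null
  -- for `μ - ν`. A Markov kernel preserves total mass, hence equality.
  have hle : μ - ν ≤ (μ - ν).bind κ := by
    refine Measure.le_iff.2 fun t _ => ?_
    calc (μ - ν) t ≤ (μ - ν) (t ∩ sᶜ) + (μ - ν) s :=
          (measure_mono (by intro x hx; by_cases hxs : x ∈ s <;> simp [hx, hxs])).trans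
            (measure_union_le _ _)
      _ = (μ - ν) (t ∩ sᶜ) := by rw [hs₁, add_zero]
      _ ≤ (μ - ν) (t ∩ sᶜ) + (ν - μ).bind κ (t ∩ sᶜ) := le_self_add
      _ = (μ - ν).bind κ (t ∩ sᶜ) := by
        rw [← hbalance, measure_mono_null Set.inter_subset_right hs₂, zero_add]
      _ ≤ (μ - ν).bind κ t := measure_mono Set.inter_subset_left
  refine (Measure.eq_of_le_of_measure_univ_eq hle ?_).symm
  rw [Measure.bind_apply .univ κ.aemeasurable]
  simp

theorem Invariant.ae_apply_eq_zero (hμ : κ.Invariant μ) {s : Set α} (hs : MeasurableSet s)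
    (h : μ s = 0) : ∀ᵐ x ∂μ, κ x s = 0 := by
  rw [← hμ.def, Measure.bind_apply hs κ.aemeasurable,
    lintegral_eq_zero_iff (κ.measurable_coe hs)] at h
  exact h

end Invariance

/-! ### Accessible points and uniqueness -/

section Accessible

variable {α : Type*} [TopologicalSpace α] [MeasurableSpace α] [OpensMeasurableSpace α]
  {κ : Kernel α α} {μ : Measure α} {y : α}

/-- A point whose neighbourhoods are all reached from everywhere adheres to every set of full
measure for an invariant measure. -/
theorem Invariant.mem_closure_of_ae_mem (hμ : κ.Invariant μ) (hμ0 : μ ≠ 0)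
    (hy : ∀ U : Set α, IsOpen U → y ∈ U → ∀ x, ∃ t : ℕ, 0 < (κ ^ t) x U)
    {s : Set α} (hs : ∀ᵐ x ∂μ, x ∈ s) : y ∈ closure s := by
  by_contra hys
  have hnull : μ (closure s)ᶜ = 0 :=
    measure_mono_null (Set.compl_subset_compl.2 subset_closure) hs
  have hae : ∀ᵐ x ∂μ, ∀ t : ℕ, (κ ^ t) x (closure s)ᶜ = 0 := ae_all_iff.2 fun t =>
    (hμ.pow t).ae_apply_eq_zero isClosed_closure.measurableSet.compl hnull
  have : NeZero μ := ⟨hμ0⟩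
  obtain ⟨x, hx⟩ := hae.exists
  obtain ⟨t, ht⟩ := hy _ isClosed_closure.isOpen_compl hys x
  exact ht.ne' (hx t)

/-- Suppose that a point `y` is accessible from everywhere, and that no measurable set `s` is such
that `y` is adherent both to the points from which `s` is avoided almost surely and to those from
which `sᶜ` is. Then there is at most one invariant probability measure. -/
theorem Invariant.eq_of_accessible [IsMarkovKernel κ] {ν : Measure α}
    [IsProbabilityMeasure μ] [IsProbabilityMeasure ν] (hμ : κ.Invariant μ) (hν : κ.Invariant ν)
    (hy : ∀ U : Set α, IsOpen U → y ∈ U → ∀ x, ∃ t : ℕ, 0 < (κ ^ t) x U)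
    (hsep : ∀ s, MeasurableSet s → y ∈ closure {x | κ x s = 0} → y ∉ closure {x | κ x sᶜ = 0}) :
    μ = ν := by
  have hsub {ρ τ : Measure α} [IsProbabilityMeasure ρ] [IsProbabilityMeasure τ]
      (h : ρ - τ = 0) : ρ = τ := by
    have hadd := τ.add_sub_comm_of_isFiniteMeasure ρ
    rw [h, add_zero] at hadd
    exact Measure.eq_of_le_of_isProbabilityMeasure (hadd ▸ Measure.le_add_right le_rfl)
  by_contra hne
  obtain ⟨s, hs, hs₁, hs₂⟩ := Measure.mutually_singular_measure_sub (μ := μ) (ν := ν)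
  exact hsep s hs
    ((hμ.sub hν).mem_closure_of_ae_mem (fun h => hne (hsub h)) hy
      ((hμ.sub hν).ae_apply_eq_zero hs hs₁))
    ((hν.sub hμ).mem_closure_of_ae_mem (fun h => hne (hsub h).symm) hy
      ((hν.sub hμ).ae_apply_eq_zero hs.compl hs₂))

end Accessible

/-! ### Existence for Feller kernels -/

section Feller

variable {α : Type*} [TopologicalSpace α] [CompactSpace α] [T2Space α] [HasOuterApproxClosed α]
  [MeasurableSpace α] [BorelSpace α] [Nonempty α]

/-- **Krylov–Bogolyubov theorem**: a Feller Markov kernel on a compact space has an invariant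
probability measure. -/
theorem exists_invariant_of_feller (κ : Kernel α α) [IsMarkovKernel κ]
    (hκ : ∀ g : α →ᵇ ℝ, Continuous fun x => ∫ y, g y ∂κ x) :
    ∃ μ : Measure α, IsProbabilityMeasure μ ∧ κ.Invariant μ := by
  obtain ⟨x₀⟩ := ‹Nonempty α›
  have hpow (n : ℕ) : IsMarkovKernel (κ ^ n) := by
    induction n with
    | zero => exact inferInstanceAs (IsMarkovKernel Kernel.id)
    | succ n ih =>
      rw [_root_.pow_succ']
      exact inferInstanceAs (IsMarkovKernel (κ ∘ₖ (κ ^ n)))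
  let A (n : ℕ) : Measure α :=
    ((n : ℝ≥0∞) + 1)⁻¹ • ∑ k ∈ Finset.range (n + 1), (κ ^ k) x₀
  have hA (n : ℕ) : IsProbabilityMeasure (A n) := by
    constructor
    simp only [A, Measure.smul_apply, Measure.finsetSum_apply, measure_univ, smul_eq_mul,
      Finset.sum_const, Finset.card_range, nsmul_eq_mul, mul_one, Nat.cast_add, Nat.cast_one]
    exact ENNReal.inv_mul_cancel (by simp) (by simp)
  have hint (g : α →ᵇ ℝ) (n : ℕ) : ∫ x, g x ∂A n =
      ((n : ℝ) + 1)⁻¹ * ∑ k ∈ Finset.range (n + 1), ∫ x, g x ∂(κ ^ k) x₀ := by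
    simp only [A]
    rw [integral_smul_measure, integral_finsetSum_measure fun k _ => g.integrable _, smul_eq_mul,
      ENNReal.toReal_inv, ENNReal.toReal_add (by simp) (by simp)]
    simp
  let P (g : α →ᵇ ℝ) : α →ᵇ ℝ := BoundedContinuousFunction.mkOfCompact ⟨_, hκ g⟩
  have hP (g : α →ᵇ ℝ) (n : ℕ) : ∫ x, P g x ∂(κ ^ n) x₀ = ∫ x, g x ∂(κ ^ (n + 1)) x₀ := by
    rw [_root_.pow_succ']
    exact (Kernel.integral_comp (κ := κ ^ n) (η := κ) (g.integrable _)).symm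
  have hdiff (g : α →ᵇ ℝ) :
      Tendsto (fun n => ∫ x, P g x ∂A n - ∫ x, g x ∂A n) atTop (𝓝 0) := by
    have hbound (k : ℕ) : ‖∫ x, g x ∂(κ ^ k) x₀‖ ≤ ‖g‖ := by
      simpa using g.norm_integral_le_mul_norm ((κ ^ k) x₀)
    refine squeeze_zero_norm (a := fun n : ℕ => (2 * ‖g‖) * (1 / ((n : ℝ) + 1))) (fun n => ?_) ?_
    · rw [hint, hint, ← mul_sub, ← Finset.sum_sub_distrib]
      simp only [hP]
      -- The Cesàro sum telescopes to two boundary terms, each at most `‖g‖`.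
      rw [Finset.sum_range_sub fun k => ∫ x, g x ∂(κ ^ k) x₀, norm_mul, mul_comm, one_div,
        Real.norm_of_nonneg (by positivity : (0 : ℝ) ≤ ((n : ℝ) + 1)⁻¹)]
      gcongr
      refine (norm_sub_le _ _).trans ?_
      linarith [hbound (n + 1), hbound 0]
    · simpa using (tendsto_one_div_add_atTop_nhds_zero_nat (𝕜 := ℝ)).const_mul (2 * ‖g‖)
  let B (n : ℕ) : ProbabilityMeasure α := ⟨A n, hA n⟩
  -- Along an ultrafilter finer than `atTop`, compactness gives a weak limit without extracting a
  -- subsequence.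
  let F : Ultrafilter ℕ := Ultrafilter.of atTop
  obtain ⟨μ, -, hμ⟩ := isCompact_univ.ultrafilter_le_nhds (F.map B) (by simp)
  have hlim := ProbabilityMeasure.tendsto_iff_forall_integral_tendsto.1
    (show Tendsto B F (𝓝 μ) from hμ)
  refine ⟨μ, inferInstance, ?_⟩
  refine ext_of_forall_integral_eq_of_IsFiniteMeasure fun g => ?_
  have hbind : ∫ x, g x ∂(μ : Measure α).bind κ = ∫ x, P g x ∂(μ : Measure α) := by
    have h := Kernel.integral_comp (κ := Kernel.const α (μ : Measure α)) (η := κ) (a := x₀)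
      (g.integrable _)
    rwa [Kernel.comp_const] at h
  rw [hbind]
  have h := tendsto_nhds_unique ((hlim (P g)).sub (hlim g))
    ((hdiff g).mono_left (Ultrafilter.of_le atTop))
  exact sub_eq_zero.1 h

end Feller

end ProbabilityTheory.Kernel

instance sphereHaar_isOpenPosMeasure (d : ℕ) : (sphereHaar d).IsOpenPosMeasure :=
  Measure.isOpenPosMeasure_smul _ (ENNReal.inv_ne_zero.2 (measure_ne_top _ _))

/-! ### The dynamics on the sphere -/

namespace SingleAgentDynamics

variable {d : ℕ} (M : SingleAgentDynamics d)

theorem transition_apply (x : OpinionSphere d) : M.transition x = M.D.map (M.step x) := rfl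

theorem measurable_step_left (x : OpinionSphere d) : Measurable (M.step x) :=
  M.measurable_step.of_uncurry_left

instance isMarkovKernel_transition : IsMarkovKernel M.transition where
  isProbabilityMeasure x := by
    have := M.isProbabilityMeasure_D
    exact Measure.isProbabilityMeasure_map (M.measurable_step_left x).aemeasurable

variable {M}

theorem IsContinuous.continuous_integral (hM : M.IsContinuous) (g : OpinionSphere d →ᵇ ℝ) :
    Continuous fun x => ∫ y, g y ∂M.transition x := by
  have := M.isProbabilityMeasure_D
  have h (x : OpinionSphere d) : ∫ y, g y ∂M.transition x = ∫ ξ, g (M.step x ξ) ∂M.D := by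
    rw [transition_apply, integral_map (M.measurable_step_left x).aemeasurable
      g.continuous.aestronglyMeasurable]
  simp_rw [h]
  refine continuous_of_dominated (bound := fun _ => ‖g‖) (fun x => ?_)
    (fun x => ae_of_all _ fun ξ => g.norm_coe_le_norm _) (integrable_const _)
    (ae_of_all _ fun ξ => g.continuous.comp (hM ξ))
  exact (g.continuous.measurable.comp (M.measurable_step_left x)).aestronglyMeasurable

theorem IsContinuous.exists_isInvariantDistribution (hM : M.IsContinuous) :
    ∃ μ : Measure (OpinionSphere d), M.IsInvariantDistribution μ := by
  have := M.isProbabilityMeasure_D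
  -- This covers `d = 0`: the empty sphere carries no probability measure.
  have : Nonempty (OpinionSphere d) := nonempty_of_isProbabilityMeasure M.D
  exact Kernel.exists_invariant_of_feller M.transition hM.continuous_integral

/-- A closed set charged fully from each point of a set is charged fully from its closure. -/
theorem IsContinuous.transition_compl_eq_zero_of_mem_closure (hM : M.IsContinuous)
    {C T : Set (OpinionSphere d)} (hC : IsClosed C) (hT : ∀ x ∈ T, M.transition x Cᶜ = 0)
    {y : OpinionSphere d} (hy : y ∈ closure T) : M.transition y Cᶜ = 0 := by
  have happly (x : OpinionSphere d) :
      M.transition x Cᶜ = 0 ↔ ∀ᵐ ξ ∂M.D, M.step x ξ ∈ C := by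
    rw [transition_apply, Measure.map_apply (M.measurable_step_left x) hC.measurableSet.compl]
    rfl
  obtain ⟨u, huT, hu⟩ := mem_closure_iff_seq_limit.1 hy
  rw [happly]
  -- A sequence involves only countably many null sets of stimuli; for every other `ξ` the limit
  -- stays in the closed set.
  filter_upwards [ae_all_iff.2 fun n => (happly _).1 (hT _ (huT n))] with ξ hξ
  exact hC.mem_of_tendsto (((hM ξ).tendsto y).comp hu) (.of_forall hξ)

section Density

variable {p : OpinionSphere d → OpinionSphere d → ℝ≥0}

theorem transition_eq_zero_iff_of_density (hmeas : ∀ x, Measurable (p x))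
    (hp : ∀ x, M.transition x = (sphereHaar d).withDensity fun y => (p x y : ℝ≥0∞))
    (x : OpinionSphere d) {s : Set (OpinionSphere d)} :
    M.transition x s = 0 ↔ sphereHaar d ({z | p x z ≠ 0} ∩ s) = 0 := by
  rw [hp, withDensity_apply_eq_zero (hmeas x).coe_nnreal_ennreal]
  simp

/-- With a density continuous in the current state, no measurable set separates the states
near a point. -/
theorem notMem_closure_of_continuous_left (hmeas : ∀ x, Measurable (p x))
    (hp : ∀ x, M.transition x = (sphereHaar d).withDensity fun y => (p x y : ℝ≥0∞))
    (hcont : ∀ z, Continuous fun x => p x z) {y : OpinionSphere d} (s : Set (OpinionSphere d))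
    (h₁ : y ∈ closure {x | M.transition x s = 0}) :
    y ∉ closure {x | M.transition x sᶜ = 0} := by
  intro h₂
  have key {t : Set (OpinionSphere d)} (h : y ∈ closure {x | M.transition x t = 0}) :
      M.transition y t = 0 := by
    obtain ⟨u, hu, hlim⟩ := mem_closure_iff_seq_limit.1 h
    rw [transition_eq_zero_iff_of_density hmeas hp]
    -- Where `p y` is nonzero, so is `p (u n)` for some `n`: countably many null sets cover.
    refine measure_mono_null ?_ (measure_iUnion_null fun n =>
      (transition_eq_zero_iff_of_density hmeas hp (u n)).1 (hu n))
    rintro z ⟨hz, hzt⟩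
    obtain ⟨n, hn⟩ := ((((hcont z).tendsto y).comp hlim).eventually_ne hz).exists
    exact Set.mem_iUnion.2 ⟨n, hn, hzt⟩
  have h := measure_univ_le_add_compl (μ := M.transition y) s
  rw [key h₁, key h₂, measure_univ] at h
  simp at h

/-- The same for a density continuous in the new state, if the dynamics are continuous. -/
theorem IsContinuous.notMem_closure_of_continuous_right (hM : M.IsContinuous)
    (hmeas : ∀ x, Measurable (p x))
    (hp : ∀ x, M.transition x = (sphereHaar d).withDensity fun y => (p x y : ℝ≥0∞))
    (hcont : ∀ x, Continuous fun z => p x z) {y : OpinionSphere d} (s : Set (OpinionSphere d))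
    (h₁ : y ∈ closure {x | M.transition x s = 0}) :
    y ∉ closure {x | M.transition x sᶜ = 0} := by
  intro h₂
  let V (x : OpinionSphere d) : Set (OpinionSphere d) := {z | p x z ≠ 0}
  have hV (x : OpinionSphere d) : IsOpen (V x) := isOpen_ne_fun (hcont x) continuous_const
  -- Avoiding `t` need not pass to the limit `y`, but landing in the closed set `closure (O t)`
  -- does. Openness makes this uncountable union harmless, since Haar measure charges nonempty open
  -- sets.
  let O (t : Set (OpinionSphere d)) : Set (OpinionSphere d) :=
    ⋃ x ∈ {x | M.transition x t = 0}, V x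
  have hO (t : Set (OpinionSphere d)) : IsOpen (O t) := isOpen_biUnion fun x _ => hV x
  have key {t : Set (OpinionSphere d)} (h : y ∈ closure {x | M.transition x t = 0}) :
      V y ⊆ closure (O t) := by
    have hnull : M.transition y (closure (O t))ᶜ = 0 := by
      refine hM.transition_compl_eq_zero_of_mem_closure isClosed_closure (fun x hx => ?_) h
      rw [transition_eq_zero_iff_of_density hmeas hp]
      convert measure_empty (μ := sphereHaar d)
      refine Set.eq_empty_of_forall_notMem fun z hz => hz.2 (subset_closure ?_)
      exact Set.mem_biUnion hx hz.1
    rw [transition_eq_zero_iff_of_density hmeas hp] at hnull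
    have hempty := ((hV y).inter isClosed_closure.isOpen_compl).eq_empty_of_measure_zero hnull
    intro z hz
    by_contra hzc
    exact Set.eq_empty_iff_forall_notMem.1 hempty z ⟨hz, hzc⟩
  have hdisj : Disjoint (O s) (O sᶜ) := by
    rw [Set.disjoint_left]
    intro z hz₁ hz₂
    obtain ⟨x₁, hx₁, hz₁⟩ := Set.mem_iUnion₂.1 hz₁
    obtain ⟨x₂, hx₂, hz₂⟩ := Set.mem_iUnion₂.1 hz₂
    have hnull : sphereHaar d (V x₁ ∩ V x₂) = 0 := by
      refine measure_mono_null ?_ (measure_union_null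
        ((transition_eq_zero_iff_of_density hmeas hp x₁).1 hx₁)
        ((transition_eq_zero_iff_of_density hmeas hp x₂).1 hx₂))
      rintro w ⟨hw₁, hw₂⟩
      by_cases hw : w ∈ s
      · exact .inl ⟨hw₁, hw⟩
      · exact .inr ⟨hw₂, hw⟩
    have hempty := ((hV x₁).inter (hV x₂)).eq_empty_of_measure_zero hnull
    exact Set.eq_empty_iff_forall_notMem.1 hempty z ⟨hz₁, hz₂⟩
  have hne : (V y).Nonempty := by
    by_contra hV0
    have h : M.transition y Set.univ = 0 := by
      rw [transition_eq_zero_iff_of_density hmeas hp]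
      simp [show {z | p y z ≠ 0} = ∅ from Set.not_nonempty_iff_eq_empty.1 hV0]
    simp at h
  obtain ⟨z, hz⟩ := hne
  -- The nonempty open set `V y` lies in both closures: it meets `O s` at some `w`, near which `O
  -- sᶜ` must also meet `O s`.
  obtain ⟨w, hwV, hwO⟩ := mem_closure_iff.1 (key h₁ hz) _ (hV y) hz
  obtain ⟨v, hv₁, hv₂⟩ := mem_closure_iff.1 (key h₂ hwV) _ (hO s) hwO
  exact Set.disjoint_left.1 hdisj hv₁ hv₂

end Density

theorem IsContinuous.isInvariantDistribution_unique (hM : M.IsContinuous)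
    {y : OpinionSphere d} (hy : M.IsAccessible y) (hp : M.HasContinuousDensity)
    {μ ν : Measure (OpinionSphere d)} (hμ : M.IsInvariantDistribution μ)
    (hν : M.IsInvariantDistribution ν) : μ = ν := by
  have := hμ.1
  have := hν.1
  obtain ⟨p, hmeas, hp, hcont⟩ := hp
  refine hμ.2.eq_of_accessible hν.2 hy fun s _ => ?_
  rcases hcont with hcont | hcont
  · exact hM.notMem_closure_of_continuous_right hmeas hp hcont s
  · exact notMem_closure_of_continuous_left hmeas hp hcont s

end SingleAgentDynamics

theorem mainTheorem8 (d : ℕ) (M : SingleAgentDynamics d) (hM : M.IsContinuous) :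
    (∃ μ : Measure (OpinionSphere d), M.IsInvariantDistribution μ) ∧
    ((∃ y : OpinionSphere d, M.IsAccessible y) → M.HasContinuousDensity →
      ∃! μ : Measure (OpinionSphere d), M.IsInvariantDistribution μ) := by
  refine ⟨hM.exists_isInvariantDistribution, fun ⟨y, hy⟩ hp => ?_⟩
  obtain ⟨μ, hμ⟩ := hM.exists_isInvariantDistribution
  exact ⟨μ, hμ, fun ν hν => hM.isInvariantDistribution_unique hy hp hν hμ⟩
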